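/- Let $\mathcal G$ be a $\sigma$-compact locally compact Hausdorff étale groupoid with source and range maps $s,r$, whose unit space $\mathcal G^{(0)}$ is compact. A set $B\subset\mathcal G$ is a bisection if it is contained in an open set on which $s$ and $r$ are homeomorphisms onto open subsets of $\mathcal G^{(0)}$. Assume that $\mathcal G$ is ample (its topology has a basis of compact open bisections) and minimal (the only closed $D\subset\mathcal G^{(0)}$ with $r(\mathcal G D)=D$ are $\emptyset$ and $\mathcal G^{(0)}$). Suppose that $\mathcal G$ is almost finite in Matui's sense: for every compact $K\subset\mathcal G$ and every $\epsilon>0$ there is a compact open principal subgroupoid $\mathcal H\subset\mathcal G$ with $\mathcal H^{(0)}=\mathcal G^{(0)}$ such that $$|K\mathcal H u\setminus\mathcal H u|<\epsilon\,|\mathcal H u|\qquad\text{for all }u\in\mathcal G^{(0)},$$ where $\mathcal H u=\{\gamma\in\mathcal H: s(\gamma)=u\}$. Then $\mathcal G$ is almost elementary, that is: for every compact $K$ with $\mathcal G^{(0)}\subset K\subset\mathcal G$, every non-empty open set $O\subset\mathcal G^{(0)}$ and every open cover $\mathcal V$ of $\mathcal G^{(0)}$ there are families of open bisections $\mathcal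 C=\{C^l_{i,j}: i,j\in F_l,\ l\in I\}$ and $\mathcal D=\{D^l_{i,j}: i,j\in E_l,\ l\in I\}$ with $I$ and all $F_l\subset E_l$ finite and with at least one $C^l_{i,i}$, $i\in F_l$, non-empty, such that 1. $\mathcal C$ and $\mathcal D$ are castles: $C^l_{i,j}C^l_{j,k}=C^l_{i,k}$ for all $i,j,k\in F_l$; for each $l$ the sets $C^l_{i,i}$, $i\in F_l$, are pairwise disjoint subsets of $\mathcal G^{(0)}$; $C^l_{i,j}C^{l'}_{i',j'}=\emptyset$ whenever $l\ne l'$; and likewise for $\mathcal D$ with the index sets $E_l$; 2. $\mathcal C$ is $K$-extendable to $\mathcal D$: $C^l_{i,j}=D^l_{i,j}$ for $i,j\in F_l$, and $K\cdot\bigsqcup_{i,j\in F_l}C^l_{i,j}\subset\bigsqcup_{i,j\in E_l}D^l_{i,j}$ for every $l\in I$; 3. every $D^l_{i,i}$ with $i\in E_l$, $l\in I$, is contained in some $V\in\mathcal V$; 4. there are finitely many open bisections $A_1,\dots,A_n$ ($n\ge 0$) such that $\mathcal G^{(0)}\setminus\bigsqcup_{l\in I}\bigsqcup_{i\in F_l}C^l_{i,i}\subset\bigcup_{k}s(A_k)$,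 and the sets $r(A_k)$ are pairwise disjoint and contained in $O$. -/

import Mathlib

open Set

/-- An algebraic groupoid on the set `G`: a set of composable pairs, a product of composable pairs,
an inverse map, and the usual laws. The product is a partial operation; the value of `mul a b`
on a non-composable pair carries no information and is never used below. -/
class SetGroupoid (G : Type*) where
  Composable : G → G → Prop
  mul : G → G → G
  inv : G → G
  composable_mul_left : ∀ a b c, Composable a b → Composable b c → Composable (mul a b) c
  composable_mul_right : ∀ a b c, Composable a b → Composable b c → Composable a (mul b c)
  mul_assoc : ∀ a b c, Composable a b → Composable b c → mul (mul a b) c = mul a (mul b c)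
  composable_inv : ∀ a, Composable a (inv a)
  inv_inv : ∀ a, inv (inv a) = a
  inv_mul_cancel_left : ∀ a b, Composable a b → mul (inv a) (mul a b) = b
  mul_inv_cancel_right : ∀ a b, Composable a b → mul (mul a b) (inv b) = a

namespace SetGroupoid

section Algebra

variable {G : Type*} [SetGroupoid G]

/-- The source map `s(γ) = γ⁻¹γ`, as a map from `G` to `G`. -/
def src (a : G) : G := mul (inv a) a

/-- The range map `r(γ) = γγ⁻¹`, as a map from `G` to `G`. -/
def rng (a : G) : G := mul a (inv a)

variable (G) in
/-- The unit space `G⁰ = {γγ⁻¹ : γ ∈ G}`, as a subset of `G`. -/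
def units : Set G := {u | ∃ a : G, u = rng a}

/-- The product `A · B` of two subsets: all products of composable pairs from `A × B`. -/
def setMul (A B : Set G) : Set G := {c | ∃ a ∈ A, ∃ b ∈ B, Composable a b ∧ c = mul a b}

/-- A set `D` of units is invariant if `r(G · D) = D`. -/
def IsInvariant (D : Set G) : Prop := rng '' setMul univ D = D

/-- A subgroupoid: a subset that is closed under products of composable pairs and inverses. -/
structure IsSubgroupoid (H : Set G) : Prop where
  mul_mem : ∀ a ∈ H, ∀ b ∈ H, Composable a b → mul a b ∈ H
  inv_mem : ∀ a ∈ H, inv a ∈ H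

/-- The subgroupoid `H` is principal: all its isotropy consists of units. -/
def IsPrincipalOn (H : Set G) : Prop := ∀ a ∈ H, src a = rng a → a ∈ units G

/-- The source fibre `H u = {γ ∈ H : s(γ) = u}`. -/
def fiber (H : Set G) (u : G) : Set G := {a | a ∈ H ∧ src a = u}

end Algebra

section Topology

variable (G : Type*) [TopologicalSpace G] [SetGroupoid G]

/-- `G` is a locally compact Hausdorff groupoid. -/
structure IsLCHGroupoid : Prop where
  t2 : T2Space G
  locallyCompact : LocallyCompactSpace G
  continuousOn_mul :
    ContinuousOn (fun p : G × G => mul p.1 p.2) {p : G × G | Composable p.1 p.2}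
  continuous_inv : Continuous (inv : G → G)

/-- `G` is a locally compact Hausdorff étale groupoid: the range map is a local homeomorphism
from `G` to itself. -/
structure IsEtale : Prop extends IsLCHGroupoid G where
  isLocalHomeomorph_rng : IsLocalHomeomorph (rng : G → G)

variable {G} in
/-- `B` is a bisection: it lies in an open set on which the source map and the range map are
homeomorphisms onto open sets of units (the unit space of an étale groupoid is open in `G`). -/
def IsBisection (B : Set G) : Prop :=
  ∃ U : Set G, IsOpen U ∧ B ⊆ U ∧
    Topology.IsOpenEmbedding (U.domRestrict (src : G → G)) ∧
    Topology.IsOpenEmbedding (U.domRestrict (rng : G → G))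

/-- `G` is ample: it is a locally compact Hausdorff étale groupoid and its topology has a basis
consisting of compact open bisections. -/
structure IsAmple : Prop extends IsEtale G where
  basis : TopologicalSpace.IsTopologicalBasis
    {B : Set G | IsCompact B ∧ IsOpen B ∧ IsBisection B}

/-- `G` is minimal: the only closed invariant sets of units are `∅` and `G⁰`. -/
def IsMinimal : Prop :=
  ∀ D : Set G, D ⊆ units G → IsClosed D → IsInvariant D → D = ∅ ∨ D = units G

variable {G} in
/-- A compact open elementary subgroupoid of `G`: a compact open principal subgroupoid. -/
structure IsCompactOpenElementary (H : Set G) : Prop where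
  isCompact : IsCompact H
  isOpen : IsOpen H
  isSubgroupoid : IsSubgroupoid H
  isPrincipal : IsPrincipalOn H

/-- `G` is almost finite in Matui's sense: for every compact `K` and `ε > 0` there is a compact
open elementary subgroupoid `H` with unit space `G⁰` such that `|K H u \ H u| < ε |H u|` for all
units `u`. In an étale groupoid the sets counted here are finite. -/
def IsAlmostFinite : Prop :=
  ∀ K : Set G, IsCompact K → ∀ ε : ℝ, 0 < ε →
    ∃ H : Set G, IsCompactOpenElementary H ∧ rng '' H = units G ∧
      ∀ u ∈ units G,
        ((setMul K (fiber H u) \ fiber H u).ncard : ℝ) < ε * ((fiber H u).ncard : ℝ)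

variable {G}

/-- The relation `K ≺ V` for a compact set `K` and an open set `V` of units: there are finitely
many open bisections whose sources cover `K` and whose ranges are disjoint and lie in `V`. -/
def DynPrec (K V : Set G) : Prop :=
  ∃ (n : ℕ) (A : Fin n → Set G),
    (∀ i, IsOpen (A i) ∧ IsBisection (A i)) ∧
    K ⊆ (⋃ i, src '' A i) ∧
    (∀ i j, i ≠ j → Disjoint (rng '' A i) (rng '' A j)) ∧
    (⋃ i, rng '' A i) ⊆ V

/-- `{C i j : i, j ∈ F}` is a multisection. -/
structure IsMultisection {ι : Type*} (F : Finset ι) (C : ι → ι → Set G) : Prop where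
  isBisection : ∀ i ∈ F, ∀ j ∈ F, IsBisection (C i j)
  setMul_eq : ∀ i ∈ F, ∀ j ∈ F, ∀ k ∈ F, setMul (C i j) (C j k) = C i k
  level_subset : ∀ i ∈ F, C i i ⊆ units G
  level_disjoint : ∀ i ∈ F, ∀ j ∈ F, i ≠ j → Disjoint (C i i) (C j j)

/-- `{C l i j : i, j ∈ F l, l ∈ I}` is an open castle: a finite family of multisections made of open
bisections, with all products between different multisections empty. -/
structure IsOpenCastle {I ι : Type*} [Finite I] (F : I → Finset ι) (C : I → ι → ι → Set G) :
    Prop where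
  isMultisection : ∀ l, IsMultisection (F l) (C l)
  isOpen : ∀ l, ∀ i ∈ F l, ∀ j ∈ F l, IsOpen (C l i j)
  setMul_eq_empty : ∀ l l', l ≠ l' → ∀ i ∈ F l, ∀ j ∈ F l, ∀ i' ∈ F l', ∀ j' ∈ F l',
    setMul (C l i j) (C l' i' j') = ∅

/-- The castle `C` (with index sets `F l`) is `K`-extendable to the castle `D` (with index sets
`E l`): `C` is a sub-castle of `D`, and `K · ⋃ C^l ⊆ ⋃ D^l` for every `l`. -/
structure IsExtendableTo {I ι : Type*} (K : Set G) (F : I → Finset ι) (C : I → ι → ι → Set G)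
    (E : I → Finset ι) (D : I → ι → ι → Set G) : Prop where
  subset : ∀ l, F l ⊆ E l
  eq : ∀ l, ∀ i ∈ F l, ∀ j ∈ F l, C l i j = D l i j
  setMul_subset : ∀ l,
    setMul K (⋃ i ∈ F l, ⋃ j ∈ F l, C l i j) ⊆ ⋃ i ∈ E l, ⋃ j ∈ E l, D l i j

variable (G) in
/-- `G`, an étale groupoid with compact unit space, is almost elementary. The castle `C` has to be
nontrivial (some level is nonempty): otherwise the empty castle could be used whenever `G⁰ ≺ O`. -/
def IsAlmostElementary : Prop :=
  ∀ K : Set G, IsCompact K → units G ⊆ K →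
  ∀ O : Set G, IsOpen O → O ⊆ units G → O.Nonempty →
  ∀ 𝒱 : Set (Set G), (∀ V ∈ 𝒱, IsOpen V ∧ V ⊆ units G) → units G ⊆ ⋃₀ 𝒱 →
    ∃ (n : ℕ) (F E : Fin n → Finset ℕ) (C D : Fin n → ℕ → ℕ → Set G),
      IsOpenCastle F C ∧ IsOpenCastle E D ∧
      (∃ l, ∃ i ∈ F l, (C l i i).Nonempty) ∧
      IsExtendableTo K F C E D ∧
      (∀ l, ∀ i ∈ E l, ∃ V ∈ 𝒱, D l i i ⊆ V) ∧
      DynPrec (units G \ ⋃ l, ⋃ i ∈ F l, C l i i) O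

end Topology

end SetGroupoid

/-! Shrink `O` to a non-empty compact open `O'`. By minimality and compactness of the unit space,
some compact `L` moves every unit into `O'`. Cover `K ∪ L` by `M` compact open bisections, let `B`
be their union, and choose an elementary `H` for `B` with `ε = 1 / (M² + M + 1)`. Call a unit bad if
it lies in `Z = s(B \ H)`; a unit `v` that is not bad satisfies `B v ⊆ H`.

The orbits of `H` are finite, and a clopen partition `Q` of the units fine enough to separate their
points cuts `H` into towers, one for each set of pieces met by an orbit (`orbitType`, `tower`). If
`Q` also refines `𝒱` and splits `O'` and `Z`, the full towers form `𝒟` and the towers over the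
levels outside `Z` form `𝒞`. Multiplying such a level by `K` stays in `H`, which is extendability.

The heart is a count on one orbit (`IsSubgroupoid.card_filter_fiber_lt`). Bad points leave `H` under
`B`, so they are at most `M` times as many as the points of `B H u \ H u`. The other points are
moved into `O'` inside the orbit, so they are at most `M` times as many as the orbit points in `O'`.
The choice of `ε` then makes the bad points fewer than those in `O'`. Hence the bad levels of each
tower inject into its levels inside `O'`, and the elements of `H` between matched levels are the
bisections witnessing subordination to `O`. -/

theorem IsOpenMap.isOpenEmbedding_domRestrict {X Y : Type*} [TopologicalSpace X]
    [TopologicalSpace Y] {f : X → Y} (ho : IsOpenMap f) (hf : Continuous f)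
    {U : Set X} (hU : IsOpen U) (hi : InjOn f U) :
    Topology.IsOpenEmbedding (U.domRestrict f) :=
  .of_continuous_injective_isOpenMap (hf.comp continuous_subtype_val)
    (injOn_iff_injective.1 hi) (ho.comp hU.isOpenMap_subtype_val)

namespace SetGroupoid

/-! ### Groupoid algebra from the partial-product axioms. -/

section Algebra

variable {G : Type*} [SetGroupoid G] {a b : G}

theorem composable_inv_left (a : G) : Composable (inv a) a := by
  simpa only [inv_inv] using composable_inv (inv a)

theorem src_inv (a : G) : src (inv a) = rng a := by simp only [src, rng, inv_inv]

theorem rng_inv (a : G) : rng (inv a) = src a := by simp only [src, rng, inv_inv]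

theorem src_mul_self (h : Composable a b) : mul (src a) b = b := by
  rw [src, mul_assoc _ _ _ (composable_inv_left a) h, inv_mul_cancel_left _ _ h]

theorem rng_mul_self (a : G) : mul (rng a) a = a := by
  simpa only [inv_inv, rng] using mul_inv_cancel_right a (inv a) (composable_inv a)

theorem composable_rng_self (a : G) : Composable (rng a) a :=
  composable_mul_left _ _ _ (composable_inv a) (composable_inv_left a)

theorem composable_self_src (a : G) : Composable a (src a) :=
  composable_mul_right _ _ _ (composable_inv a) (composable_inv_left a)

theorem mul_src_self (a : G) : mul a (src a) = a := by
  rw [src, ← mul_assoc _ _ _ (composable_inv a) (composable_inv_left a)]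
  exact rng_mul_self a

/-- For composable `a`, `b`, the product of `src a` and `b` is `b`, so cancelling `b` on the right
exhibits `src a` as `rng b`. -/
theorem composable_iff : Composable a b ↔ src a = rng b := by
  constructor
  · intro h
    have hc : Composable (src a) b := composable_mul_left _ _ _ (composable_inv_left a) h
    have := mul_inv_cancel_right _ _ hc
    rw [src_mul_self h] at this
    exact this.symm
  · intro h
    have h₁ : Composable a (rng b) := h ▸ composable_self_src a
    have h₂ := composable_mul_left _ _ _ h₁ (composable_rng_self b)
    rwa [← h, mul_src_self] at h₂

theorem src_mul (h : Composable a b) : src (mul a b) = src b := by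
  rw [composable_iff.1 (composable_mul_left _ _ _ h (composable_inv b)), rng_inv]

theorem rng_mul (h : Composable a b) : rng (mul a b) = rng a := by
  rw [← composable_iff.1 (composable_mul_right _ _ _ (composable_inv_left a) h), src_inv]

theorem rng_rng (a : G) : rng (rng a) = rng a := rng_mul (composable_inv a)

theorem src_rng (a : G) : src (rng a) = rng a := by
  rw [composable_iff.1 (composable_rng_self a)]

theorem src_eq_rng_comp_inv : (src : G → G) = rng ∘ inv := by
  funext a
  exact (rng_inv a).symm

theorem rng_mem_units (a : G) : rng a ∈ units G := ⟨a, rfl⟩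

theorem rng_of_mem_units (h : a ∈ units G) : rng a = a := by
  obtain ⟨c, rfl⟩ := h
  exact rng_rng c

theorem src_of_mem_units (h : a ∈ units G) : src a = a := by
  obtain ⟨c, rfl⟩ := h
  exact src_rng c

theorem units_eq_range : units G = range (rng : G → G) := by
  ext u
  simp [units, eq_comm]

theorem composable_inv_right_iff : Composable a (inv b) ↔ src a = src b := by
  rw [composable_iff, rng_inv]

theorem mul_mul_inv_of_src_eq (h : src a = src b) : mul (mul a (inv b)) b = a := by
  simpa only [inv_inv] using mul_inv_cancel_right a (inv b) (composable_inv_right_iff.2 h)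

theorem eq_of_mul_inv_mem_units (h : src a = src b) (hu : mul a (inv b) ∈ units G) : a = b := by
  have hc := composable_inv_right_iff.2 h
  have hs : src (mul a (inv b)) = rng b := by rw [src_mul hc, src_inv]
  rw [src_of_mem_units hu] at hs
  have := mul_mul_inv_of_src_eq h
  rwa [hs, rng_mul_self, eq_comm] at this

theorem mul_left_cancel_of_composable {c : G} (h : Composable a b) (h' : Composable a c)
    (e : mul a b = mul a c) : b = c := by
  rw [← inv_mul_cancel_left _ _ h, e, inv_mul_cancel_left _ _ h']

namespace IsSubgroupoid

variable {H : Set G}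

theorem mul_inv_mem (hH : IsSubgroupoid H) (ha : a ∈ H) (hb : b ∈ H) (h : src a = src b) :
    mul a (inv b) ∈ H :=
  hH.mul_mem _ ha _ (hH.inv_mem _ hb) (composable_inv_right_iff.2 h)

theorem rng_mem (hH : IsSubgroupoid H) (ha : a ∈ H) : rng a ∈ H :=
  hH.mul_mem _ ha _ (hH.inv_mem _ ha) (composable_inv a)

theorem units_subset (hH : IsSubgroupoid H) (h : rng '' H = units G) : units G ⊆ H := by
  rw [← h]
  rintro _ ⟨a, ha, rfl⟩
  exact hH.rng_mem ha

theorem mul_mem_iff_left (hH : IsSubgroupoid H) (hb : b ∈ H) (h : Composable a b) :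
    mul a b ∈ H ↔ a ∈ H := by
  refine ⟨fun hm => ?_, fun ha => hH.mul_mem _ ha _ hb h⟩
  have := hH.mul_inv_mem hm hb (src_mul h)
  rwa [mul_inv_cancel_right _ _ h] at this

/-- In a principal subgroupoid an element is determined by its source and range. -/
theorem eq_of_src_rng (hH : IsSubgroupoid H) (hp : IsPrincipalOn H) (ha : a ∈ H) (hb : b ∈ H)
    (hs : src a = src b) (hr : rng a = rng b) : a = b := by
  have hc := composable_inv_right_iff.2 hs
  refine eq_of_mul_inv_mem_units hs (hp _ (hH.mul_inv_mem ha hb hs) ?_)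
  rw [src_mul hc, rng_mul hc, src_inv, hr]

end IsSubgroupoid

end Algebra

/-! ### Étale and ample groupoids: bisections and clopen partitions. -/

section Topology

variable {G : Type*} [TopologicalSpace G] [SetGroupoid G]

namespace IsEtale

theorem continuous_rng (h : IsEtale G) : Continuous (rng : G → G) :=
  h.isLocalHomeomorph_rng.continuous

theorem continuous_src (h : IsEtale G) : Continuous (src : G → G) := by
  rw [src_eq_rng_comp_inv]
  exact h.continuous_rng.comp h.continuous_inv

theorem isOpenMap_rng (h : IsEtale G) : IsOpenMap (rng : G → G) :=
  h.isLocalHomeomorph_rng.isOpenMap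

theorem isOpenMap_src (h : IsEtale G) : IsOpenMap (src : G → G) := by
  rw [src_eq_rng_comp_inv]
  refine h.isOpenMap_rng.comp fun U hU => ?_
  rw [image_eq_preimage_of_inverse inv_inv inv_inv]
  exact hU.preimage h.continuous_inv

theorem isOpen_units (h : IsEtale G) : IsOpen (units G) := by
  rw [units_eq_range]
  exact h.isOpenMap_rng.isOpen_range

/-- Source and range are continuous open maps, so injectivity on an open set is all that a bisection
needs. -/
theorem isBisection_of_injOn (h : IsEtale G) {U : Set G} (hU : IsOpen U)
    (hs : InjOn (src : G → G) U) (hr : InjOn (rng : G → G) U) : IsBisection U :=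
  ⟨U, hU, Subset.rfl, h.isOpenMap_src.isOpenEmbedding_domRestrict h.continuous_src hU hs,
    h.isOpenMap_rng.isOpenEmbedding_domRestrict h.continuous_rng hU hr⟩

end IsEtale

theorem IsBisection.injOn_src {B : Set G} (h : IsBisection B) : InjOn (src : G → G) B := by
  obtain ⟨U, -, hBU, hs, -⟩ := h
  exact (injOn_iff_injective.2 hs.injective).mono hBU

theorem IsBisection.injOn_rng {B : Set G} (h : IsBisection B) : InjOn (rng : G → G) B := by
  obtain ⟨U, -, hBU, -, hr⟩ := h
  exact (injOn_iff_injective.2 hr.injective).mono hBU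

/-- A compact set in an ample groupoid lies in a finite union of compact open bisections. -/
theorem IsAmple.exists_finite_bisection_cover (h : IsAmple G) {K : Set G} (hK : IsCompact K) :
    ∃ (t : Finset G) (B : G → Set G),
      (∀ x ∈ t, IsCompact (B x) ∧ IsOpen (B x) ∧ IsBisection (B x)) ∧ K ⊆ ⋃ x ∈ t, B x := by
  have hx : ∀ x : G, ∃ B : Set G, (IsCompact B ∧ IsOpen B ∧ IsBisection B) ∧ x ∈ B := fun x => by
    obtain ⟨B, hB, hxB, -⟩ := h.basis.exists_subset_of_mem_open (mem_univ x) isOpen_univ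
    exact ⟨B, hB, hxB⟩
  choose B hB hxB using hx
  obtain ⟨t, -, ht⟩ := hK.elim_nhds_subcover B fun x _ => (hB x).2.1.mem_nhds (hxB x)
  exact ⟨t, B, fun x _ => hB x, ht⟩

/-- If each point of a compact open set `X` of an ample groupoid has a neighbourhood with a
hereditary property, then `X` has a finite clopen partition into sets with that property. -/
theorem IsAmple.exists_clopen_partition (h : IsAmple G) {X : Set G} (hX : IsCompact X)
    (hXo : IsOpen X) (p : Set G → Prop) (hp : ∀ P P', P ⊆ P' → p P' → p P)
    (hx : ∀ x ∈ X, ∃ P ∈ nhds x, p P) :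
    ∃ (q : ℕ) (Q : ℕ → Set G), (∀ i, IsClopen (Q i)) ∧ (∀ i, Q i ⊆ X) ∧
      Pairwise (Function.onFun Disjoint Q) ∧ (∀ x ∈ X, ∃ i ∈ Finset.range q, x ∈ Q i) ∧
      ∀ i ∈ Finset.range q, p (Q i) := by
  have := h.t2
  have hex : ∀ x : G, ∃ B : Set G, IsClopen B ∧ B ⊆ X ∧ (x ∈ X → x ∈ B ∧ p B) := fun x => by
    by_cases hxX : x ∈ X
    · obtain ⟨P, hP, hpP⟩ := hx x hxX
      obtain ⟨B, hB, hxB, hBP⟩ :=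
        h.basis.mem_nhds_iff.1 (Filter.inter_mem hP (hXo.mem_nhds hxX))
      exact ⟨B, ⟨hB.1.isClosed, hB.2.1⟩, hBP.trans inter_subset_right,
        fun _ => ⟨hxB, hp _ _ (hBP.trans inter_subset_left) hpP⟩⟩
    · exact ⟨∅, isClopen_empty, empty_subset _, fun hh => absurd hh hxX⟩
  choose B hBc hBX hB using hex
  obtain ⟨t, htX, ht⟩ :=
    hX.elim_nhds_subcover B fun x hxX => (hBc x).isOpen.mem_nhds (hB x hxX).1
  let e := t.equivFin
  -- The finite cover is padded with `∅` to a sequence, so that `disjointed` applies; the padded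
  -- terms contain no points.
  let f : ℕ → Set G := fun i => if hi : i < t.card then B (e.symm ⟨i, hi⟩) else ∅
  have hf : ∀ i, IsClopen (f i) ∧ f i ⊆ X := fun i => by
    by_cases hi : i < t.card
    · simp only [f, dif_pos hi]
      exact ⟨hBc _, hBX _⟩
    · simp only [f, dif_neg hi]
      exact ⟨isClopen_empty, empty_subset _⟩
  refine ⟨t.card, disjointed f, fun i => ?_, fun i => (disjointed_subset f i).trans (hf i).2,
    disjoint_disjointed f, fun x hxX => ?_, fun i hi => ?_⟩
  · exact disjointedRec (p := fun s : Set G => IsClopen s) (fun s j hs => hs.diff (hf j).1)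
      (hf i).1
  · have hxf : x ∈ ⋃ i, f i := by
      obtain ⟨y, hy, hxy⟩ := mem_iUnion₂.1 (ht hxX)
      refine mem_iUnion.2 ⟨e ⟨y, hy⟩, ?_⟩
      simp only [f, Fin.is_lt, dif_pos, Fin.eta, Equiv.symm_apply_apply]
      exact hxy
    rw [← iUnion_disjointed] at hxf
    obtain ⟨i, hi⟩ := mem_iUnion.1 hxf
    refine ⟨i, Finset.mem_range.2 ?_, hi⟩
    by_contra hlt
    have := disjointed_subset f i hi
    simp only [f, dif_neg hlt] at this
    exact this
  · have hi' := Finset.mem_range.1 hi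
    refine hp _ _ (disjointed_subset f i) ?_
    simp only [f, dif_pos hi']
    exact (hB _ (htX _ (e.symm ⟨i, hi'⟩).2)).2

end Topology

/-! ### Towers of an elementary subgroupoid over a transversal partition. -/

section Tower

variable {G : Type*} [SetGroupoid G]

/-- A sequence `Q` of sets whose first `q` terms partition the unit space, and such that every
orbit of the subgroupoid `H` meets each of these terms in at most one point. -/
structure IsTransversalPartition (H : Set G) (q : ℕ) (Q : ℕ → Set G) : Prop where
  subset_units : ∀ i, Q i ⊆ units G
  disjoint : Pairwise (Function.onFun Disjoint Q)
  exists_mem : ∀ u ∈ units G, ∃ i ∈ Finset.range q, u ∈ Q i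
  rng_eq_src : ∀ i ∈ Finset.range q, ∀ a ∈ H, src a ∈ Q i → rng a ∈ Q i → src a = rng a

open Classical in
/-- The indices of those sets among `Q 0, …, Q (q - 1)` that the `H`-orbit of `u` meets. -/
noncomputable def orbitType (H : Set G) (q : ℕ) (Q : ℕ → Set G) (u : G) : Finset ℕ :=
  (Finset.range q).filter fun i => ∃ a ∈ H, src a = u ∧ rng a ∈ Q i

/-- The elements of `H` from `Q j` to `Q i` over the units whose orbit type is `T`. -/
def tower (H : Set G) (q : ℕ) (Q : ℕ → Set G) (T : Finset ℕ) (i j : ℕ) : Set G :=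
  {a | a ∈ H ∧ rng a ∈ Q i ∧ src a ∈ Q j ∧ orbitType H q Q (src a) = T}

variable {H : Set G} {q : ℕ} {Q : ℕ → Set G} {T : Finset ℕ} {i j : ℕ} {a b u : G}

theorem mem_orbitType : i ∈ orbitType H q Q u ↔
    i ∈ Finset.range q ∧ ∃ a ∈ H, src a = u ∧ rng a ∈ Q i := by
  classical
  simp only [orbitType, Finset.mem_filter]

theorem orbitType_subset_range : orbitType H q Q u ⊆ Finset.range q :=
  fun _ hi => (mem_orbitType.1 hi).1

/-- Translating by `a` or its inverse identifies the two fibres of `H` without changing ranges; the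
type is an invariant of the orbit. -/
theorem orbitType_rng (hH : IsSubgroupoid H) (ha : a ∈ H) :
    orbitType H q Q (rng a) = orbitType H q Q (src a) := by
  ext i
  simp only [mem_orbitType]
  refine and_congr_right fun _ => ⟨?_, ?_⟩
  · rintro ⟨b, hb, hs, hr⟩
    have hc := composable_iff.2 hs
    exact ⟨mul b a, hH.mul_mem _ hb _ ha hc, src_mul hc, by rwa [rng_mul hc]⟩
  · rintro ⟨b, hb, hs, hr⟩
    have hc := composable_inv_right_iff.2 hs
    exact ⟨mul b (inv a), hH.mul_inv_mem hb ha hs, by rw [src_mul hc, src_inv],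
      by rwa [rng_mul hc]⟩

namespace IsTransversalPartition

theorem eq_of_mem (hQ : IsTransversalPartition H q Q) (hi : u ∈ Q i) (hj : u ∈ Q j) : i = j := by
  by_contra hne
  exact disjoint_left.1 (hQ.disjoint hne) hi hj

/-- The product of `a` and `inv b` has both ends in `Q i`, so transversality gives `a` and `b` the
same range, and principality finishes. -/
theorem eq_of_src_eq (hQ : IsTransversalPartition H q Q) (hH : IsSubgroupoid H)
    (hp : IsPrincipalOn H) (hi : i ∈ Finset.range q) (ha : a ∈ H) (hb : b ∈ H)
    (hs : src a = src b) (hra : rng a ∈ Q i) (hrb : rng b ∈ Q i) : a = b := by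
  have hc := composable_inv_right_iff.2 hs
  refine hH.eq_of_src_rng hp ha hb hs ?_
  have := hQ.rng_eq_src i hi _ (hH.mul_inv_mem ha hb hs)
    (by rwa [src_mul hc, src_inv]) (by rwa [rng_mul hc])
  rw [src_mul hc, src_inv, rng_mul hc] at this
  exact this.symm

theorem injOn_src_tower (hQ : IsTransversalPartition H q Q) (hH : IsSubgroupoid H)
    (hp : IsPrincipalOn H) (hi : i ∈ Finset.range q) :
    InjOn (src : G → G) (tower H q Q T i j) :=
  fun _ ha _ hb hs => hQ.eq_of_src_eq hH hp hi ha.1 hb.1 hs ha.2.1 hb.2.1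

theorem injOn_rng_tower (hQ : IsTransversalPartition H q Q) (hH : IsSubgroupoid H)
    (hp : IsPrincipalOn H) (hj : j ∈ Finset.range q) :
    InjOn (rng : G → G) (tower H q Q T i j) := fun a ha b hb hr => by
  have := hQ.eq_of_src_eq hH hp hj (hH.inv_mem _ ha.1) (hH.inv_mem _ hb.1)
    (by rwa [src_inv, src_inv]) (by rw [rng_inv]; exact ha.2.2.1) (by rw [rng_inv]; exact hb.2.2.1)
  rw [← inv_inv a, this, inv_inv]

theorem tower_self_subset_units (hQ : IsTransversalPartition H q Q) (hp : IsPrincipalOn H)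
    (hi : i ∈ Finset.range q) : tower H q Q T i i ⊆ units G :=
  fun _ ha => hp _ ha.1 (hQ.rng_eq_src i hi _ ha.1 ha.2.2.1 ha.2.1)

theorem mem_of_mem_tower_self (hQ : IsTransversalPartition H q Q) (hp : IsPrincipalOn H)
    (hi : i ∈ Finset.range q) (ha : a ∈ tower H q Q T i i) : a ∈ Q i := by
  have := ha.2.1
  rwa [rng_of_mem_units (hQ.tower_self_subset_units hp hi ha)] at this

theorem mem_tower_self (hQ : IsTransversalPartition H q Q) (hH : units G ⊆ H) (hu : u ∈ Q i) :
    u ∈ tower H q Q (orbitType H q Q u) i i := by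
  have huu := hQ.subset_units i hu
  refine ⟨hH huu, ?_, ?_, ?_⟩
  · rwa [rng_of_mem_units huu]
  · rwa [src_of_mem_units huu]
  · rw [src_of_mem_units huu]

end IsTransversalPartition

/-- Since `j` lies in the type of the orbit, some element of `H` leads from the source of `c` into
`Q j`, and `c` factors through it. -/
theorem setMul_tower (hH : IsSubgroupoid H) {k : ℕ} (hj : j ∈ T) :
    setMul (tower H q Q T i j) (tower H q Q T j k) = tower H q Q T i k := by
  ext c
  constructor
  · rintro ⟨a, ha, b, hb, hc, rfl⟩
    refine ⟨hH.mul_mem _ ha.1 _ hb.1 hc, ?_, ?_, ?_⟩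
    · rw [rng_mul hc]; exact ha.2.1
    · rw [src_mul hc]; exact hb.2.2.1
    · rw [src_mul hc]; exact hb.2.2.2
  · intro hcm
    obtain ⟨hcH, hr, hs, hT⟩ := hcm
    rw [← hT] at hj
    obtain ⟨-, b, hb, hsb, hrb⟩ := mem_orbitType.1 hj
    have hc := composable_inv_right_iff.2 hsb.symm
    refine ⟨mul c (inv b), ⟨hH.mul_inv_mem hcH hb hsb.symm, ?_, ?_, ?_⟩, b, ⟨hb, hrb, ?_, ?_⟩, ?_,
      (mul_mul_inv_of_src_eq hsb.symm).symm⟩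
    · rwa [rng_mul hc]
    · rwa [src_mul hc, src_inv]
    · rw [src_mul hc, src_inv, orbitType_rng hH hb, hsb, hT]
    · rwa [hsb]
    · rw [hsb, hT]
    · rw [composable_iff, src_mul hc, src_inv]

theorem setMul_tower_eq_empty (hH : IsSubgroupoid H) {T' : Finset ℕ} (h : T ≠ T') {i' j' : ℕ} :
    setMul (tower H q Q T i j) (tower H q Q T' i' j') = ∅ := by
  refine eq_empty_of_forall_notMem ?_
  rintro _ ⟨a, ha, b, hb, hc, -⟩
  refine h ?_
  rw [← ha.2.2.2, ← hb.2.2.2, composable_iff.1 hc, orbitType_rng hH hb.1]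

section Topology

variable [TopologicalSpace G]

/-- The points whose orbit meets `Q i` form the source image of a compact open set, which is clopen;
hence the type is locally constant. -/
theorem isOpen_orbitType_eq (hG : IsEtale G) (hHc : IsCompact H) (hHo : IsOpen H)
    (hQc : ∀ i, IsClopen (Q i)) : IsOpen {u | orbitType H q Q u = T} := by
  have := hG.t2
  have hS : ∀ i, IsClopen (src '' (H ∩ rng ⁻¹' Q i)) := fun i =>
    ⟨((hHc.inter_right ((hQc i).isClosed.preimage hG.continuous_rng)).image
      hG.continuous_src).isClosed,
      hG.isOpenMap_src _ (hHo.inter ((hQc i).isOpen.preimage hG.continuous_rng))⟩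
  have hmem : ∀ i u, i ∈ orbitType H q Q u ↔
      i ∈ Finset.range q ∧ u ∈ src '' (H ∩ rng ⁻¹' Q i) := fun i u => by
    rw [mem_orbitType]
    refine and_congr_right fun _ => ⟨?_, ?_⟩
    · rintro ⟨a, ha, hs, hr⟩
      exact ⟨a, ⟨ha, hr⟩, hs⟩
    · rintro ⟨a, ⟨ha, hr⟩, hs⟩
      exact ⟨a, ha, hs, hr⟩
  refine isOpen_iff_mem_nhds.2 fun u hu => ?_
  have hev : ∀ᶠ v in nhds u, ∀ i ∈ Finset.range q,
      (v ∈ src '' (H ∩ rng ⁻¹' Q i) ↔ u ∈ src '' (H ∩ rng ⁻¹' Q i)) := by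
    rw [Filter.eventually_all_finset]
    intro i _
    by_cases hi : u ∈ src '' (H ∩ rng ⁻¹' Q i)
    · filter_upwards [(hS i).isOpen.mem_nhds hi] with v hv using iff_of_true hv hi
    · filter_upwards [(hS i).compl.isOpen.mem_nhds hi] with v hv using iff_of_false hv hi
  filter_upwards [hev] with v hv
  rw [← (show orbitType H q Q u = T from hu)]
  ext i
  rw [hmem, hmem]
  exact and_congr_right fun hi => hv i hi

theorem isOpen_tower (hG : IsEtale G) (hHc : IsCompact H) (hHo : IsOpen H)
    (hQc : ∀ i, IsClopen (Q i)) : IsOpen (tower H q Q T i j) :=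
  hHo.inter <| ((hQc i).isOpen.preimage hG.continuous_rng).inter <|
    ((hQc j).isOpen.preimage hG.continuous_src).inter <|
      (isOpen_orbitType_eq hG hHc hHo hQc).preimage hG.continuous_src

theorem IsTransversalPartition.isBisection_tower (hQ : IsTransversalPartition H q Q)
    (hG : IsEtale G) (hH : IsCompactOpenElementary H) (hQc : ∀ i, IsClopen (Q i))
    (hi : i ∈ Finset.range q) (hj : j ∈ Finset.range q) : IsBisection (tower H q Q T i j) :=
  hG.isBisection_of_injOn (isOpen_tower hG hH.isCompact hH.isOpen hQc)
    (hQ.injOn_src_tower hH.isSubgroupoid hH.isPrincipal hi)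
    (hQ.injOn_rng_tower hH.isSubgroupoid hH.isPrincipal hj)

theorem IsTransversalPartition.isOpenCastle (hQ : IsTransversalPartition H q Q)
    (hG : IsEtale G) (hH : IsCompactOpenElementary H) (hQc : ∀ i, IsClopen (Q i))
    {I : Type*} [Finite I] {T : I → Finset ℕ} (hTi : Function.Injective T)
    (hTq : ∀ l, T l ⊆ Finset.range q) {F : I → Finset ℕ} (hF : ∀ l, F l ⊆ T l) :
    IsOpenCastle F fun l => tower H q Q (T l) where
  isMultisection l :=
    { isBisection := fun _ hi _ hj =>
        hQ.isBisection_tower hG hH hQc (hTq l (hF l hi)) (hTq l (hF l hj))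
      setMul_eq := fun _ _ _ hj _ _ => setMul_tower hH.isSubgroupoid (hF l hj)
      level_subset := fun _ hi => hQ.tower_self_subset_units hH.isPrincipal (hTq l (hF l hi))
      level_disjoint := fun _ hi _ hj hne =>
        (hQ.disjoint hne).mono
          (fun _ => hQ.mem_of_mem_tower_self hH.isPrincipal (hTq l (hF l hi)))
          (fun _ => hQ.mem_of_mem_tower_self hH.isPrincipal (hTq l (hF l hj))) }
  isOpen _ _ _ _ _ := isOpen_tower hG hH.isCompact hH.isOpen hQc
  setMul_eq_empty _ _ hne _ _ _ _ _ _ _ _ :=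
    setMul_tower_eq_empty hH.isSubgroupoid (hTi.ne hne)

end Topology

end Tower

/-! ### Separating orbits, and the use of minimality. -/

section Separation

variable {G : Type*} [TopologicalSpace G] [SetGroupoid G]

/-- Every unit has a neighbourhood that meets each orbit of a compact open principal subgroupoid
at most once. -/
theorem IsCompactOpenElementary.exists_nhds_separating (hG : IsEtale G) {H : Set G}
    (hH : IsCompactOpenElementary H) (u : G) :
    ∃ P ∈ nhds u, ∀ a ∈ H, src a ∈ P → rng a ∈ P → src a = rng a := by
  have := hG.t2
  -- Units are open, so `H \ units G` is compact; by principality its image under source and range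
  -- misses the diagonal.
  have hc : IsClosed ((fun a : G => (src a, rng a)) '' (H \ units G)) :=
    ((hH.isCompact.diff hG.isOpen_units).image
      (hG.continuous_src.prodMk hG.continuous_rng)).isClosed
  have hn : (u, u) ∉ (fun a : G => (src a, rng a)) '' (H \ units G) := by
    rintro ⟨a, ⟨haH, hau⟩, he⟩
    have h₁ := Prod.mk.inj he
    exact hau (hH.isPrincipal a haH (h₁.1.trans h₁.2.symm))
  obtain ⟨P, hP, P', hP', hPP⟩ := mem_nhds_prod_iff.1 (hc.isOpen_compl.mem_nhds hn)
  refine ⟨P ∩ P', Filter.inter_mem hP hP', fun a ha hs hr => ?_⟩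
  by_cases hau : a ∈ units G
  · rw [src_of_mem_units hau, rng_of_mem_units hau]
  · exact absurd ⟨a, ⟨ha, hau⟩, rfl⟩ (hPP (mk_mem_prod hs.1 hr.2))

/-- In a minimal groupoid every orbit meets every nonempty open set of units. -/
theorem IsMinimal.exists_src_eq_rng_mem (hm : IsMinimal G) (hG : IsEtale G)
    (hu : IsCompact (units G)) {O : Set G} (hO : IsOpen O) (hOu : O ⊆ units G)
    (hne : O.Nonempty) {u : G} (huu : u ∈ units G) : ∃ a : G, src a = u ∧ rng a ∈ O := by
  have := hG.t2
  -- The units whose orbit meets `O`. This set is open and contains `O`, so its closed invariant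
  -- complement must be empty.
  set W : Set G := src '' (rng ⁻¹' O : Set G)
  have hW : IsOpen W := hG.isOpenMap_src _ (hO.preimage hG.continuous_rng)
  have hinv : IsInvariant (units G \ W) := by
    refine Subset.antisymm ?_ fun v hv => ?_
    · rintro _ ⟨_, ⟨a, -, d, hd, hc, rfl⟩, rfl⟩
      refine ⟨rng_mem_units _, ?_⟩
      rintro ⟨b, hb, hs⟩
      rw [rng_mul hc] at hs
      have hba := composable_iff.2 hs
      refine hd.2 ⟨mul b a, ?_, ?_⟩
      · rw [mem_preimage, rng_mul hba]
        exact hb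
      · rw [src_mul hba, composable_iff.1 hc, rng_of_mem_units hd.1]
    · have hc : Composable v v := by
        rw [composable_iff, src_of_mem_units hv.1, rng_of_mem_units hv.1]
      exact ⟨mul v v, ⟨v, mem_univ v, v, hv, hc, rfl⟩, by rw [rng_mul hc, rng_of_mem_units hv.1]⟩
  rcases hm _ sdiff_subset (hu.diff hW).isClosed hinv with h | h
  · have huW : u ∈ W := by
      by_contra hn
      exact (h ▸ (⟨huu, hn⟩ : u ∈ units G \ W) : u ∈ (∅ : Set G))
    obtain ⟨a, ha, hs⟩ := huW
    exact ⟨a, hs, ha⟩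
  · obtain ⟨o, ho⟩ := hne
    have hoW : o ∈ units G \ W := by rw [h]; exact hOu ho
    exact absurd ⟨o, by rwa [mem_preimage, rng_of_mem_units (hOu ho)],
      src_of_mem_units (hOu ho)⟩ hoW.2

theorem IsAmple.exists_compact_src_eq_rng_mem (hG : IsAmple G) (hm : IsMinimal G)
    (hu : IsCompact (units G)) {O : Set G} (hO : IsOpen O) (hOu : O ⊆ units G)
    (hne : O.Nonempty) :
    ∃ L : Set G, IsCompact L ∧ ∀ u ∈ units G, ∃ a ∈ L, src a = u ∧ rng a ∈ O := by
  have hex : ∀ u : G, ∃ B : Set G, IsCompact B ∧ IsOpen B ∧ B ⊆ rng ⁻¹' O ∧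
      (u ∈ units G → u ∈ src '' B) := fun u => by
    by_cases huu : u ∈ units G
    · obtain ⟨a, hs, hr⟩ := hm.exists_src_eq_rng_mem hG.toIsEtale hu hO hOu hne huu
      obtain ⟨B, hB, haB, hBO⟩ := hG.basis.exists_subset_of_mem_open (u := rng ⁻¹' O)
        hr (hO.preimage hG.continuous_rng)
      exact ⟨B, hB.1, hB.2.1, hBO, fun _ => ⟨a, haB, hs⟩⟩
    · exact ⟨∅, isCompact_empty, isOpen_empty, empty_subset _, fun h => absurd h huu⟩
  choose B hBc hBo hBO hB using hex
  obtain ⟨t, -, ht⟩ := hu.elim_nhds_subcover (fun u => src '' B u) fun u huu =>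
    (hG.isOpenMap_src _ (hBo u)).mem_nhds (hB u huu)
  refine ⟨⋃ u ∈ t, B u, t.isCompact_biUnion fun u _ => hBc u, fun u huu => ?_⟩
  obtain ⟨v, hv, a, ha, hs⟩ := mem_iUnion₂.1 (ht huu)
  exact ⟨a, mem_biUnion hv ha, hs, hBO v ha⟩

theorem DynPrec.of_finite {K V : Set G} {ι : Type*} [Finite ι] (A : ι → Set G)
    (hA : ∀ i, IsOpen (A i) ∧ IsBisection (A i)) (hK : K ⊆ ⋃ i, src '' A i)
    (hd : ∀ i j, i ≠ j → Disjoint (rng '' A i) (rng '' A j)) (hV : ⋃ i, rng '' A i ⊆ V) :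
    DynPrec K V := by
  obtain ⟨n, ⟨e⟩⟩ := Finite.exists_equiv_fin ι
  refine ⟨n, A ∘ e.symm, fun i => hA _, ?_, fun i j hij => hd _ _ (e.symm.injective.ne hij), ?_⟩
  · exact (e.symm.surjective.iUnion_comp fun i => src '' A i).symm ▸ hK
  · exact (e.symm.surjective.iUnion_comp fun i => rng '' A i).symm ▸ hV

end Separation

/-! ### Counting points in an orbit. -/

section Counting

variable {G : Type*} [SetGroupoid G]

theorem finite_inter_src_preimage {t : Finset G} {B : G → Set G}
    (hB : ∀ x ∈ t, InjOn (src : G → G) (B x)) {S : Set G} (hS : S.Finite) :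
    ((⋃ x ∈ t, B x) ∩ src ⁻¹' S).Finite := by
  rw [iUnion₂_inter]
  refine t.finite_toSet.biUnion fun x hx => ?_
  exact Finite.of_injOn (f := src) (t := S) (fun a ha => ha.2)
    ((hB x hx).mono inter_subset_left) hS

theorem finite_setMul {t : Finset G} {B : G → Set G}
    (hB : ∀ x ∈ t, InjOn (src : G → G) (B x)) {S : Set G} (hS : S.Finite) :
    (setMul (⋃ x ∈ t, B x) S).Finite := by
  refine (Finite.image2 mul (finite_inter_src_preimage hB (hS.image rng)) hS).subset ?_
  rintro _ ⟨a, ha, b, hb, hc, rfl⟩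
  exact ⟨a, ⟨ha, b, hb, (composable_iff.1 hc).symm⟩, b, hb, rfl⟩

/-- If left multiplication by elements of a union of `t.card` bisections takes every element of `S`
into `N`, then `S` has at most `t.card * N.card` elements. -/
theorem card_le_mul_card_of_mul_mem {t : Finset G} {B : G → Set G}
    (hB : ∀ x ∈ t, InjOn (rng : G → G) (B x)) {S N : Finset G}
    (hS : ∀ a ∈ S, ∃ k ∈ ⋃ x ∈ t, B x, Composable k a ∧ mul k a ∈ N) :
    S.card ≤ t.card * N.card := by
  have hS' : ∀ a, ∃ x k, a ∈ S → x ∈ t ∧ k ∈ B x ∧ Composable k a ∧ mul k a ∈ N := fun a => by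
    by_cases ha : a ∈ S
    · obtain ⟨k, hk, hc, hN⟩ := hS a ha
      obtain ⟨x, hx, hkx⟩ := mem_iUnion₂.1 hk
      exact ⟨x, k, fun _ => ⟨hx, hkx, hc, hN⟩⟩
    · exact ⟨a, a, fun h => absurd h ha⟩
  choose x k hxk using hS'
  rw [← Finset.card_product]
  refine Finset.card_le_card_of_injOn (fun a => (x a, mul (k a) a))
    (fun a ha => Finset.mem_coe.2 (Finset.mem_product.2 ⟨(hxk a ha).1, (hxk a ha).2.2.2⟩)) ?_
  intro a ha b hb he
  obtain ⟨hx, hkx, hc, -⟩ := hxk a ha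
  obtain ⟨-, hkx', hc', -⟩ := hxk b hb
  obtain ⟨he₁, he₂⟩ := Prod.mk.inj he
  -- The product has the range of its left factor, and within one bisection the range determines
  -- that factor.
  have hk : k a = k b := by
    refine hB _ hx hkx (he₁ ▸ hkx') ?_
    rw [← rng_mul hc, he₂, rng_mul hc']
  rw [← hk] at he₂ hc'
  exact mul_left_cancel_of_composable hc hc' he₂

variable {H : Set G} {q : ℕ} {Q : ℕ → Set G} {u : G}

-- Sending `a` to the index of the piece containing its range matches orbit points with levels; it
-- converts counts in a fibre into counts of levels.
open Classical in
theorem IsTransversalPartition.card_filter_orbitType (hQ : IsTransversalPartition H q Q)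
    (hH : IsSubgroupoid H) (hp : IsPrincipalOn H) (hf : (fiber H u).Finite) {X : Set G}
    (hX : ∀ i ∈ Finset.range q, Q i ⊆ X ∨ Disjoint (Q i) X) :
    ((orbitType H q Q u).filter fun i => Q i ⊆ X).card =
      (hf.toFinset.filter fun a => rng a ∈ X).card := by
  choose idx hidx using fun a : G => hQ.exists_mem (rng a) (rng_mem_units a)
  symm
  refine Finset.card_nbij idx ?_ ?_ ?_
  · intro a ha
    simp only [Finset.coe_filter, Finite.mem_toFinset, mem_ofPred_eq] at ha
    simp only [Finset.coe_filter, mem_ofPred_eq, mem_orbitType]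
    refine ⟨⟨(hidx a).1, a, ha.1.1, ha.1.2, (hidx a).2⟩, ?_⟩
    exact (hX _ (hidx a).1).resolve_right fun hd => disjoint_left.1 hd (hidx a).2 ha.2
  · intro a ha b hb he
    simp only [Finset.coe_filter, Finite.mem_toFinset, mem_ofPred_eq] at ha hb
    exact hQ.eq_of_src_eq hH hp (hidx a).1 ha.1.1 hb.1.1 (ha.1.2.trans hb.1.2.symm) (hidx a).2
      (he ▸ (hidx b).2)
  · intro i hi
    simp only [Finset.coe_filter, mem_ofPred_eq, mem_orbitType] at hi
    obtain ⟨⟨hiq, a, ha, hs, hr⟩, hiX⟩ := hi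
    refine ⟨a, ?_, hQ.eq_of_mem (hidx a).2 hr⟩
    simp only [Finset.coe_filter, Finite.mem_toFinset, mem_ofPred_eq]
    exact ⟨⟨ha, hs⟩, hiX hr⟩

open Classical in
/-- If `|K H u \ H u|` is small and every `K`-orbit meets `O`, then the orbit `r(H u)` has fewer
points `v` with `K v ⊈ H` than points in `O`, and some of its points `v` satisfy `K v ⊆ H`. -/
theorem IsSubgroupoid.card_filter_fiber_lt (hH : IsSubgroupoid H) {t : Finset G} {B : G → Set G}
    (hBs : ∀ x ∈ t, InjOn (src : G → G) (B x)) (hBr : ∀ x ∈ t, InjOn (rng : G → G) (B x))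
    {O : Set G} (hO : ∀ u ∈ units G, ∃ a ∈ ⋃ x ∈ t, B x, src a = u ∧ rng a ∈ O)
    (hf : (fiber H u).Finite)
    (hlt : (t.card ^ 2 + t.card + 1) * (setMul (⋃ x ∈ t, B x) (fiber H u) \ fiber H u).ncard <
      (fiber H u).ncard) :
    (hf.toFinset.filter fun a => rng a ∈ src '' ((⋃ x ∈ t, B x) \ H)).card <
        (hf.toFinset.filter fun a => rng a ∈ O).card ∧
      (hf.toFinset.filter fun a => rng a ∈ src '' ((⋃ x ∈ t, B x) \ H)).card <
        hf.toFinset.card := by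
  have hN : (setMul (⋃ x ∈ t, B x) (fiber H u) \ fiber H u).Finite :=
    (finite_setMul hBs hf).subset sdiff_subset
  rw [ncard_eq_toFinset_card _ hN, ncard_eq_toFinset_card _ hf] at hlt
  have h₁ : (hf.toFinset.filter fun a => rng a ∈ src '' ((⋃ x ∈ t, B x) \ H)).card ≤
      t.card * hN.toFinset.card := by
    refine card_le_mul_card_of_mul_mem hBr fun a ha => ?_
    obtain ⟨haf, k, ⟨hkB, hkH⟩, hs⟩ := Finset.mem_filter.1 ha
    rw [Finite.mem_toFinset] at haf
    have hc := composable_iff.2 hs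
    refine ⟨k, hkB, hc, hN.mem_toFinset.2 ⟨⟨k, hkB, a, haf, hc, rfl⟩, fun hm => hkH ?_⟩⟩
    exact (hH.mul_mem_iff_left haf.1 hc).1 hm.1
  have h₂ : (hf.toFinset.filter fun a => ¬ rng a ∈ src '' ((⋃ x ∈ t, B x) \ H)).card ≤
      t.card * (hf.toFinset.filter fun a => rng a ∈ O).card := by
    refine card_le_mul_card_of_mul_mem hBr fun a ha => ?_
    obtain ⟨haf, hn⟩ := Finset.mem_filter.1 ha
    rw [Finite.mem_toFinset] at haf
    obtain ⟨k, hk, hs, hr⟩ := hO _ (rng_mem_units a)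
    have hc := composable_iff.2 hs
    have hkH : k ∈ H := by
      by_contra hkH
      exact hn ⟨k, ⟨hk, hkH⟩, hs⟩
    refine ⟨k, hk, hc, Finset.mem_filter.2 ⟨hf.mem_toFinset.2 ⟨?_, ?_⟩, ?_⟩⟩
    · exact hH.mul_mem _ hkH _ haf.1 hc
    · rw [src_mul hc, haf.2]
    · rwa [rng_mul hc]
  have h₃ := Finset.card_filter_add_card_filter_not (s := hf.toFinset)
    fun a => rng a ∈ src '' ((⋃ x ∈ t, B x) \ H)
  generalize (hf.toFinset.filter fun a => rng a ∈ src '' ((⋃ x ∈ t, B x) \ H)).card = b at *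
  generalize (hf.toFinset.filter fun a => ¬ rng a ∈ src '' ((⋃ x ∈ t, B x) \ H)).card = g at *
  generalize (hf.toFinset.filter fun a => rng a ∈ O).card = o at *
  generalize hN.toFinset.card = n at *
  generalize hf.toFinset.card = m at *
  generalize t.card = M at *
  have h₄ : M * b ≤ M * (M * n) := Nat.mul_le_mul_left M h₁
  refine ⟨?_, by nlinarith⟩
  -- With `m = b + g`, `b ≤ M n`, `g ≤ M o` and `m > (M² + M + 1) n`, one gets `M o ≥ m - b > (M² +
  -- 1) n ≥ M b`.
  have h₅ : M * b < M * o := by nlinarith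
  exact lt_of_mul_lt_mul_left h₅ (Nat.zero_le M)

end Counting

/-! ### Extendability of the castle. -/

section Extension

variable {G : Type*} [SetGroupoid G] {H : Set G} {q : ℕ} {Q : ℕ → Set G}

/-- If the levels in `F l ⊆ T l` consist of units `v` with `K v ⊆ H`, then the castle over `F` is
`K`-extendable to the castle over `T`. -/
theorem IsTransversalPartition.isExtendableTo (hQ : IsTransversalPartition H q Q)
    (hH : IsSubgroupoid H) {I : Type*} {T F : I → Finset ℕ} (hF : ∀ l, F l ⊆ T l) {K : Set G}
    (hK : ∀ l, ∀ i ∈ F l, ∀ k ∈ K, src k ∈ Q i → k ∈ H) :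
    IsExtendableTo K F (fun l => tower H q Q (T l)) T (fun l => tower H q Q (T l)) where
  subset := hF
  eq _ _ _ _ _ := rfl
  setMul_subset l := by
    rintro _ ⟨k, hk, c, hcm, hc, rfl⟩
    obtain ⟨i, hi, hcm⟩ := mem_iUnion₂.1 hcm
    obtain ⟨j, hj, hcm⟩ := mem_iUnion₂.1 hcm
    have hkH : k ∈ H := hK l i hi k hk (composable_iff.1 hc ▸ hcm.2.1)
    have hkc := hH.mul_mem _ hkH _ hcm.1 hc
    -- The product stays in `H` over the same source, so the piece containing its range is a level
    -- of the same tower.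
    obtain ⟨i', hi', hr⟩ := hQ.exists_mem _ (rng_mem_units (mul k c))
    have hT : i' ∈ T l := by
      rw [← hcm.2.2.2]
      exact mem_orbitType.2 ⟨hi', mul k c, hkc, src_mul hc, hr⟩
    refine mem_biUnion (Finset.mem_coe.2 hT) (mem_biUnion (Finset.mem_coe.2 (hF l hj)) ?_)
    refine ⟨hkc, hr, ?_, ?_⟩
    · rw [src_mul hc]; exact hcm.2.2.1
    · rw [src_mul hc]; exact hcm.2.2.2

end Extension

/-! ### Matching bad levels with levels in `O`, and assembling the castles. -/

section Main

variable {G : Type*} [TopologicalSpace G] [SetGroupoid G]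

theorem _root_.IsClopen.exists_mem_nhds_subset_or_disjoint {X : Type*} [TopologicalSpace X]
    {Z : Set X} (hZ : IsClopen Z) (x : X) : ∃ P ∈ nhds x, P ⊆ Z ∨ Disjoint P Z := by
  by_cases hx : x ∈ Z
  · exact ⟨Z, hZ.isOpen.mem_nhds hx, .inl Subset.rfl⟩
  · exact ⟨Zᶜ, hZ.compl.isOpen.mem_nhds hx, .inr disjoint_compl_left⟩

/-- The unit space has a finite clopen partition that is transversal to the orbits of `H`, refines
the cover `𝒱` and splits the clopen sets `O` and `Z`. -/
theorem IsCompactOpenElementary.exists_transversal_partition (hG : IsAmple G)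
    (hu : IsCompact (units G)) {H : Set G} (hH : IsCompactOpenElementary H) {𝒱 : Set (Set G)}
    (h𝒱 : ∀ V ∈ 𝒱, IsOpen V) (hc : units G ⊆ ⋃₀ 𝒱) {O Z : Set G} (hO : IsClopen O)
    (hZ : IsClopen Z) :
    ∃ (q : ℕ) (Q : ℕ → Set G), IsTransversalPartition H q Q ∧ (∀ i, IsClopen (Q i)) ∧
      ∀ i ∈ Finset.range q, (∃ V ∈ 𝒱, Q i ⊆ V) ∧ (Q i ⊆ O ∨ Disjoint (Q i) O) ∧
        (Q i ⊆ Z ∨ Disjoint (Q i) Z) := by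
  have hp : ∀ P P' : Set G, P ⊆ P' →
      ((∀ a ∈ H, src a ∈ P' → rng a ∈ P' → src a = rng a) ∧ (∃ V ∈ 𝒱, P' ⊆ V) ∧
        (P' ⊆ O ∨ Disjoint P' O) ∧ (P' ⊆ Z ∨ Disjoint P' Z)) →
      (∀ a ∈ H, src a ∈ P → rng a ∈ P → src a = rng a) ∧ (∃ V ∈ 𝒱, P ⊆ V) ∧
        (P ⊆ O ∨ Disjoint P O) ∧ (P ⊆ Z ∨ Disjoint P Z) := by
    rintro P P' h ⟨h₁, ⟨V, hV, hPV⟩, h₃, h₄⟩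
    exact ⟨fun a ha hs hr => h₁ a ha (h hs) (h hr), ⟨V, hV, h.trans hPV⟩,
      h₃.imp h.trans fun hd => hd.mono_left h, h₄.imp h.trans fun hd => hd.mono_left h⟩
  obtain ⟨q, Q, hQc, hQu, hQd, hQm, hQp⟩ := hG.exists_clopen_partition hu
    hG.toIsEtale.isOpen_units _ hp fun u huu => by
    obtain ⟨P₁, hP₁, h₁⟩ := hH.exists_nhds_separating hG.toIsEtale u
    obtain ⟨V, hV, huV⟩ := hc huu
    obtain ⟨P₃, hP₃, h₃⟩ := hO.exists_mem_nhds_subset_or_disjoint u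
    obtain ⟨P₄, hP₄, h₄⟩ := hZ.exists_mem_nhds_subset_or_disjoint u
    have s₁ : P₁ ∩ V ∩ (P₃ ∩ P₄) ⊆ P₁ := fun x hx => hx.1.1
    have s₃ : P₁ ∩ V ∩ (P₃ ∩ P₄) ⊆ P₃ := fun x hx => hx.2.1
    have s₄ : P₁ ∩ V ∩ (P₃ ∩ P₄) ⊆ P₄ := fun x hx => hx.2.2
    exact ⟨P₁ ∩ V ∩ (P₃ ∩ P₄), Filter.inter_mem
      (Filter.inter_mem hP₁ ((h𝒱 V hV).mem_nhds huV)) (Filter.inter_mem hP₃ hP₄),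
      fun a ha hs hr => h₁ a ha (s₁ hs) (s₁ hr), ⟨V, hV, fun x hx => hx.1.2⟩,
      h₃.imp s₃.trans fun hd => hd.mono_left s₃, h₄.imp s₄.trans fun hd => hd.mono_left s₄⟩
  exact ⟨q, Q, ⟨hQu, hQd, hQm, fun i hi => (hQp i hi).1⟩, hQc, fun i hi => (hQp i hi).2⟩

theorem _root_.Finset.exists_mapsTo_injOn_of_card_le {α β : Type*} [Nonempty β] {s : Finset α}
    {t : Finset β} (h : s.card ≤ t.card) : ∃ f : α → β, (∀ a ∈ s, f a ∈ t) ∧ InjOn f s := by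
  classical
  obtain ⟨e⟩ := Function.Embedding.nonempty_of_card_le (α := s) (β := t) (by simpa using h)
  refine ⟨fun a => if ha : a ∈ s then e ⟨a, ha⟩ else Classical.arbitrary β, fun a ha => ?_,
    fun a ha b hb hab => ?_⟩
  · simp only [dif_pos ha, Finset.coe_mem]
  · simp only [dif_pos (Finset.mem_coe.1 ha), dif_pos (Finset.mem_coe.1 hb)] at hab
    exact congrArg Subtype.val (e.injective (Subtype.ext hab))

variable {H : Set G} {q : ℕ} {Q : ℕ → Set G}

/-- If in each tower the levels listed in `bad` can be matched injectively with levels inside `O`,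
then the complement of the remaining levels is dynamically below `O`. -/
theorem IsTransversalPartition.dynPrec (hQ : IsTransversalPartition H q Q) (hG : IsEtale G)
    (hH : IsCompactOpenElementary H) (hHu : units G ⊆ H) (hQc : ∀ i, IsClopen (Q i))
    {n : ℕ} {T : Fin n → Finset ℕ} (hTi : Function.Injective T)
    (hTs : ∀ u ∈ units G, ∃ l, T l = orbitType H q Q u)
    (bad : Finset ℕ → Finset ℕ) {O : Set G}
    (φ : Finset ℕ → ℕ → ℕ)
    (hφm : ∀ u ∈ units G, ∀ i ∈ bad (orbitType H q Q u),
      φ (orbitType H q Q u) i ∈ orbitType H q Q u ∧ Q (φ (orbitType H q Q u) i) ⊆ O)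
    (hφi : ∀ u ∈ units G, InjOn (φ (orbitType H q Q u)) (bad (orbitType H q Q u))) :
    DynPrec (units G \ ⋃ l, ⋃ i ∈ T l \ bad (T l), tower H q Q (T l) i i) O := by
  -- Only types realised by a unit are kept, since `φ` is controlled on those alone.
  let ι := {p : Fin n × Fin q // ((p.2 : ℕ) ∈ bad (T p.1)) ∧
    ∃ u ∈ units G, orbitType H q Q u = T p.1}
  refine DynPrec.of_finite (ι := ι)
    (fun p => tower H q Q (T p.1.1) (φ (T p.1.1) p.1.2) p.1.2) ?_ ?_ ?_ ?_
  · rintro ⟨⟨l, i⟩, hi, u, hu, hul⟩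
    refine ⟨isOpen_tower hG hH.isCompact hH.isOpen hQc, ?_⟩
    have := (hφm u hu i (by rwa [hul])).1
    have := orbitType_subset_range this
    rw [hul] at this
    exact hQ.isBisection_tower hG hH hQc this
      (Finset.mem_range.2 i.2)
  · rintro v ⟨hv, hn⟩
    obtain ⟨i, hi, hvi⟩ := hQ.exists_mem v hv
    obtain ⟨l, hl⟩ := hTs v hv
    have hit : i ∈ orbitType H q Q v :=
      mem_orbitType.2 ⟨hi, v, hHu hv, src_of_mem_units hv, by rwa [rng_of_mem_units hv]⟩
    have hib : i ∈ bad (orbitType H q Q v) := by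
      by_contra hib
      refine hn (mem_iUnion.2 ⟨l, mem_biUnion (Finset.mem_coe.2 (?_ : i ∈ _)) ?_⟩)
      · rw [hl]
        exact Finset.mem_sdiff.2 ⟨hit, hib⟩
      · rw [hl]
        exact hQ.mem_tower_self hHu hvi
    obtain ⟨-, a, ha, hs, hr⟩ := mem_orbitType.1 (hφm v hv i hib).1
    refine mem_iUnion.2 ⟨⟨(l, ⟨i, Finset.mem_range.1 hi⟩), by rwa [hl], v, hv, hl.symm⟩, a, ?_, hs⟩
    refine ⟨ha, ?_, ?_, ?_⟩
    · change rng a ∈ Q (φ (T l) i)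
      rwa [hl]
    · rwa [hs]
    · rw [hs, hl]
  -- A common range point has a single orbit type, which fixes the tower, and lies in a single
  -- piece, so injectivity of `φ` fixes the level.
  · rintro ⟨⟨l, i⟩, hi, u, hu, hul⟩ ⟨⟨l', i'⟩, hi', hu'⟩ hne
    refine disjoint_left.2 ?_
    rintro _ ⟨a, ha, rfl⟩ ⟨b, hb, hab⟩
    have hll : l = l' := by
      refine hTi ?_
      rw [← ha.2.2.2, ← hb.2.2.2, ← orbitType_rng hH.isSubgroupoid ha.1, ← hab,
        orbitType_rng hH.isSubgroupoid hb.1]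
    subst hll
    have he := hQ.eq_of_mem ha.2.1 (hab ▸ hb.2.1)
    have := hφi u hu (by rw [hul]; exact hi) (by rw [hul]; exact hi') (by rw [hul]; exact he)
    exact hne (Subtype.ext (Prod.ext rfl (Fin.ext this)))
  · refine iUnion_subset ?_
    rintro ⟨⟨l, i⟩, hi, u, hu, hul⟩ _ ⟨a, ha, rfl⟩
    have := (hφm u hu i (by rwa [hul])).2
    rw [hul] at this
    exact this ha.2.1

open Classical in
/-- A minimal ample groupoid with compact unit space that is almost finite is almost elementary. -/
theorem IsAlmostFinite.isAlmostElementary (h_af : IsAlmostFinite G) (h_ample : IsAmple G)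
    (h_units : IsCompact (units G)) (h_min : IsMinimal G) : IsAlmostElementary G := by
  intro K hK _ O hO hOu ⟨o, ho⟩ 𝒱 h𝒱 hcov
  have hE := h_ample.toIsEtale
  have := hE.t2
  obtain ⟨O', hO', hoO', hO'O⟩ := h_ample.basis.exists_subset_of_mem_open ho hO
  have hO'c : IsClopen O' := ⟨hO'.1.isClosed, hO'.2.1⟩
  obtain ⟨L, hL, hLO⟩ := h_ample.exists_compact_src_eq_rng_mem h_min h_units hO'.2.1
    (hO'O.trans hOu) ⟨o, hoO'⟩
  obtain ⟨t, B, hB, hKL⟩ := h_ample.exists_finite_bisection_cover (hK.union hL)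
  have hBc : IsCompact (⋃ x ∈ t, B x) := t.isCompact_biUnion fun x hx => (hB x hx).1
  have hBo : IsOpen (⋃ x ∈ t, B x) := isOpen_biUnion fun x hx => (hB x hx).2.1
  obtain ⟨H, hH, hHr, hHlt⟩ := h_af _ hBc (1 / (t.card ^ 2 + t.card + 1)) (by positivity)
  have hHu := hH.isSubgroupoid.units_subset hHr
  set Z : Set G := src '' ((⋃ x ∈ t, B x) \ H)
  have hZ : IsClopen Z := ⟨((hBc.diff hH.isOpen).image hE.continuous_src).isClosed,
    hE.isOpenMap_src _ (hBo.sdiff hH.isCompact.isClosed)⟩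
  obtain ⟨q, Q, hQ, hQc, hQp⟩ := hH.exists_transversal_partition h_ample h_units
    (fun V hV => (h𝒱 V hV).1) hcov hO'c hZ
  have hcard : ∀ u ∈ units G,
      ((orbitType H q Q u).filter fun i => Q i ⊆ Z).card <
        ((orbitType H q Q u).filter fun i => Q i ⊆ O').card ∧
      ((orbitType H q Q u).filter fun i => Q i ⊆ Z).card < (orbitType H q Q u).card := by
    intro u hu
    have hlt := hHlt u hu
    have hf : (fiber H u).Finite := by
      -- An infinite fibre would have `ncard` zero, which the strict inequality of almost finiteness
      -- excludes.
      refine finite_of_ncard_pos (Nat.pos_of_ne_zero fun h0 => ?_)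
      rw [h0, Nat.cast_zero, mul_zero] at hlt
      exact absurd hlt (not_lt.2 (Nat.cast_nonneg _))
    have hT : (orbitType H q Q u).card = hf.toFinset.card := by
      have := hQ.card_filter_orbitType hH.isSubgroupoid hH.isPrincipal hf (X := univ)
        fun i _ => .inl (subset_univ _)
      simpa only [subset_univ, mem_univ, Finset.filter_true] using this
    rw [hT, hQ.card_filter_orbitType hH.isSubgroupoid hH.isPrincipal hf fun i hi => (hQp i hi).2.1,
      hQ.card_filter_orbitType hH.isSubgroupoid hH.isPrincipal hf fun i hi => (hQp i hi).2.2]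
    refine hH.isSubgroupoid.card_filter_fiber_lt (fun x hx => (hB x hx).2.2.injOn_src)
      (fun x hx => (hB x hx).2.2.injOn_rng) (fun v hv => ?_) hf ?_
    · obtain ⟨a, ha, h⟩ := hLO v hv
      exact ⟨a, hKL (.inr ha), h⟩
    · rw [one_div, inv_mul_eq_div, lt_div_iff₀ (by positivity), mul_comm] at hlt
      exact_mod_cast hlt
  -- The matching depends on the type and not on the unit, so it is constant along each tower.
  have hφ : ∀ T : Finset ℕ, ∃ φ : ℕ → ℕ, ∀ u ∈ units G, orbitType H q Q u = T →
      (∀ i ∈ T.filter fun i => Q i ⊆ Z, φ i ∈ T.filter fun i => Q i ⊆ O') ∧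
      InjOn φ ↑(T.filter fun i => Q i ⊆ Z) := fun T => by
    by_cases hT : ∃ u ∈ units G, orbitType H q Q u = T
    · obtain ⟨u, hu, rfl⟩ := hT
      obtain ⟨φ, hφ⟩ := Finset.exists_mapsTo_injOn_of_card_le (hcard u hu).1.le
      exact ⟨φ, fun _ _ _ => hφ⟩
    · exact ⟨id, fun u hu h => absurd ⟨u, hu, h⟩ hT⟩
  choose φ hφ using hφ
  -- All subsets of the index range serve as types; those realised by no unit give empty towers.
  let e := (Finset.range q).powerset.equivFin
  let T : Fin (Finset.range q).powerset.card → Finset ℕ := fun l => e.symm l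
  have hTi : Function.Injective T := Subtype.val_injective.comp e.symm.injective
  have hTq : ∀ l, T l ⊆ Finset.range q := fun l => Finset.mem_powerset.1 (e.symm l).2
  have hTs : ∀ u, ∃ l, T l = orbitType H q Q u := fun u =>
    ⟨e ⟨orbitType H q Q u, Finset.mem_powerset.2 orbitType_subset_range⟩, by
      simp only [T, Equiv.symm_apply_apply]⟩
  let bad : Finset ℕ → Finset ℕ := fun T => T.filter fun i => Q i ⊆ Z
  have hF : ∀ l, T l \ bad (T l) ⊆ T l := fun l => Finset.sdiff_subset
  refine ⟨_, fun l => T l \ bad (T l), T, fun l => tower H q Q (T l), fun l => tower H q Q (T l),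
    hQ.isOpenCastle hE hH hQc hTi hTq hF, hQ.isOpenCastle hE hH hQc hTi hTq fun _ => Subset.rfl,
    ?_, hQ.isExtendableTo hH.isSubgroupoid hF ?_, fun l i hi => ?_, ?_⟩
  -- Not every level over the orbit of `o` is bad, which makes `𝒞` nontrivial.
  · obtain ⟨i, hi, hib⟩ := Finset.exists_mem_notMem_of_card_lt_card (hcard o (hOu ho)).2
    obtain ⟨-, a, ha, hs, hr⟩ := mem_orbitType.1 hi
    obtain ⟨l, hl⟩ := hTs o
    refine ⟨l, i, ?_, rng a, ?_⟩
    · change i ∈ T l \ bad (T l)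
      rw [hl]
      exact Finset.mem_sdiff.2 ⟨hi, hib⟩
    · have := hQ.mem_tower_self hHu hr
      rwa [orbitType_rng hH.isSubgroupoid ha, hs, ← hl] at this
  · intro l i hi k hk hs
    obtain ⟨hiT, hib⟩ := Finset.mem_sdiff.1 hi
    have hd := (hQp i (hTq l hiT)).2.2.resolve_left fun h => hib (Finset.mem_filter.2 ⟨hiT, h⟩)
    by_contra hkH
    exact disjoint_left.1 hd hs ⟨k, ⟨hKL (.inl hk), hkH⟩, rfl⟩
  · obtain ⟨V, hV, hQV⟩ := (hQp i (hTq l hi)).1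
    exact ⟨V, hV, fun a ha => hQV (hQ.mem_of_mem_tower_self hH.isPrincipal (hTq l hi) ha)⟩
  · refine hQ.dynPrec hE hH hHu hQc hTi (fun u _ => hTs u) bad φ
      (fun u hu i hi => ?_) fun u hu => (hφ _ u hu rfl).2
    obtain ⟨h₁, h₂⟩ := Finset.mem_filter.1 ((hφ _ u hu rfl).1 i hi)
    exact ⟨h₁, h₂.trans hO'O⟩

end Main

end SetGroupoid

theorem theorem6p4 {G : Type*} [TopologicalSpace G] [SetGroupoid G] [SigmaCompactSpace G]
    (h_ample : SetGroupoid.IsAmple G)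
    (h_units : IsCompact (SetGroupoid.units G))
    (h_min : SetGroupoid.IsMinimal G)
    (h_af : SetGroupoid.IsAlmostFinite G) :
    SetGroupoid.IsAlmostElementary G :=
  h_af.isAlmostElementary h_ample h_units h_min
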